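/- Let $\alpha^{(0)},\beta^{(0)},\alpha^{(1)},\beta^{(1)}\in\mathbb C$ and let $(x_n)_{n\ge 0}$ be a sequence of non-zero complex numbers with $x_{n+4}x_n=\alpha^{(0)}x_{n+3}x_{n+1}+\beta^{(0)}x_{n+2}^2$ for all $n\ge 0$. For a sequence $(y_n)_{n\ge0}$ consider the odd Somos-4 equation $$x_n y_{n+4}-\alpha^{(0)}x_{n+1}y_{n+3}-2\beta^{(0)}x_{n+2}y_{n+2}-\alpha^{(0)}x_{n+3}y_{n+1}+x_{n+4}y_n=\alpha^{(1)}x_{n+1}x_{n+3}+\beta^{(1)}x_{n+2}^2\qquad(n\ge 0).\tag{O}$$ Put $$\begin{aligned} C_n^{(0)}&=\alpha^{(0)}x_{n+1}^3x_{n+3}+\beta^{(0)}x_{n+1}^2x_{n+2}^2-x_n^2x_{n+3}^2,\\ C_n^{(1)}&=\alpha^{(0)}x_nx_{n+2}^3-2\alpha^{(0)}x_{n+1}^3x_{n+3}-\beta^{(0)}x_{n+1}^2x_{n+2}^2+x_n^2x_{n+3}^2,\\ C_n^{(2)}&=-2\alpha^{(0)}x_nx_{n+2}^3+\alpha^{(0)}x_{n+1}^3x_{n+3}-\beta^{(0)}x_{n+1}^2x_{n+2}^2+x_n^2x_{n+3}^2,\\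 C_n^{(3)}&=\alpha^{(0)}x_nx_{n+2}^3+\beta^{(0)}x_{n+1}^2x_{n+2}^2-x_n^2x_{n+3}^2,\\ D_n&=\alpha^{(1)}x_nx_{n+2}^3+\alpha^{(1)}x_{n+1}^3x_{n+3}+\beta^{(1)}x_{n+1}^2x_{n+2}^2, \end{aligned}$$ and, for $J^{(1)}\in\mathbb C$, $$L_n(y_n)=\sum_{i=0}^{3}C_n^{(i)}x_{n+i}^{-1}y_{n+i},\qquad F_n=D_n-J^{(1)}x_nx_{n+1}x_{n+2}x_{n+3}.$$ Assume that $C_n^{(3)}\neq0$ for all $n\ge0$. (1) Suppose $\alpha^{(0)}\ne0$, let $u^2=\alpha^{(0)}$, and let $d_m=x_{m+1}x_{m-1}/x_m^2$ for $m\ge1$. Then there are $f\in\mathbb C$ and $(v_n)_{n\ge0}$ with $v_m=-v_{m-1}+u/d_m$ and $d_{m+1}=-d_m-v_m^2-f$ for all $m\ge1$; and for every such $f$ and $(v_n)$, the sequences $$y_n^{(i)}=x_n,\qquad y_n^{(ii)}=n\,x_n,\qquad y_n^{(iii)}=-x_n\sum_{j=0}^{n-1}v_j$$ are three linearly independent solutions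 of the homogeneous equation $L_n(y_n)=0$ $(n\ge0)$. (2) Let $y^{(i)},y^{(ii)},y^{(iii)}$ be any three linearly independent solutions of $L_n(y_n)=0$ $(n\ge 0)$, for instance those in (1). Then the determinant $$W_n=\begin{vmatrix} y_{n+1}^{(i)}&y_{n+1}^{(ii)}&y_{n+1}^{(iii)}\\ y_{n+2}^{(i)}&y_{n+2}^{(ii)}&y_{n+2}^{(iii)}\\ y_{n+3}^{(i)}&y_{n+3}^{(ii)}&y_{n+3}^{(iii)}\end{vmatrix}$$ is non-zero for all $n\ge0$. For given $J^{(1)}$ set $$\begin{pmatrix}v_n^{(i)}\\v_n^{(ii)}\\v_n^{(iii)}\end{pmatrix}=\frac{x_{n+3}F_n}{C_n^{(3)}}\,W_n^{-1}\begin{pmatrix}y_{n+1}^{(ii)}y_{n+2}^{(iii)}-y_{n+1}^{(iii)}y_{n+2}^{(ii)}\\ y_{n+1}^{(iii)}y_{n+2}^{(i)}-y_{n+1}^{(i)}y_{n+2}^{(iii)}\\ y_{n+1}^{(i)}y_{n+2}^{(ii)}-y_{n+1}^{(ii)}y_{n+2}^{(i)}\end{pmatrix},$$ and, for constants $f_0^{(i)},f_0^{(ii)},f_0^{(iii)}\in\mathbb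 C$, $$f_n^{(j)}=f_0^{(j)}+\sum_{k=0}^{n-1}v_k^{(j)},\qquad y_n=\sum_{j\in\{i,ii,iii\}}f_n^{(j)}y_n^{(j)}\qquad(n\ge0).\tag{V}$$ The increments satisfy $\sum_j (f_{n+1}^{(j)}-f_n^{(j)})\,y_{n+1}^{(j)}=0=\sum_j (f_{n+1}^{(j)}-f_n^{(j)})\,y_{n+2}^{(j)}$ for all $n\ge0$. Moreover: (a) for each $J^{(1)}\in\mathbb C$, formula (V) gives the general solution of $L_n(y_n)=F_n$ $(n\ge0)$: for all constants $f_0^{(j)}$ the sequence (V) is a solution, and every solution is of the form (V) for exactly one triple $(f_0^{(i)},f_0^{(ii)},f_0^{(iii)})$; (b) with $J^{(1)}$ also arbitrary, (V) gives the general solution of (O): for all $J^{(1)}$ and $f_0^{(j)}$ the sequence (V) solves (O), and every solution of (O) is of the form (V) for exactly one $(J^{(1)},f_0^{(i)},f_0^{(ii)},f_0^{(iii)})\in\mathbb C^4$. -/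

import Mathlib

noncomputable section

namespace ShadowSomos

/-- The Somos-4 recurrence for the even part `x`, with coefficients `a0`, `b0`. -/
def IsSomosFour (a0 b0 : ℂ) (x : ℕ → ℂ) : Prop :=
  ∀ n, x (n + 4) * x n = a0 * (x (n + 3) * x (n + 1)) + b0 * x (n + 2) ^ 2

/-- The odd equation of the dual number Somos-4 recurrence: the coefficient of `ε` when
`x n + y n * ε` and the coefficients `a0 + a1 * ε`, `b0 + b1 * ε` are substituted in Somos-4. -/
def IsOddSolution (a0 b0 a1 b1 : ℂ) (x y : ℕ → ℂ) : Prop :=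
  ∀ n, x n * y (n + 4) - a0 * x (n + 1) * y (n + 3) - 2 * b0 * x (n + 2) * y (n + 2)
      - a0 * x (n + 3) * y (n + 1) + x (n + 4) * y n
    = a1 * x (n + 1) * x (n + 3) + b1 * x (n + 2) ^ 2

def C0 (a0 b0 : ℂ) (x : ℕ → ℂ) (n : ℕ) : ℂ :=
  a0 * x (n + 1) ^ 3 * x (n + 3) + b0 * x (n + 1) ^ 2 * x (n + 2) ^ 2
    - x n ^ 2 * x (n + 3) ^ 2

def C1 (a0 b0 : ℂ) (x : ℕ → ℂ) (n : ℕ) : ℂ :=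
  a0 * x n * x (n + 2) ^ 3 - 2 * a0 * x (n + 1) ^ 3 * x (n + 3)
    - b0 * x (n + 1) ^ 2 * x (n + 2) ^ 2 + x n ^ 2 * x (n + 3) ^ 2

def C2 (a0 b0 : ℂ) (x : ℕ → ℂ) (n : ℕ) : ℂ :=
  -2 * a0 * x n * x (n + 2) ^ 3 + a0 * x (n + 1) ^ 3 * x (n + 3)
    - b0 * x (n + 1) ^ 2 * x (n + 2) ^ 2 + x n ^ 2 * x (n + 3) ^ 2

def C3 (a0 b0 : ℂ) (x : ℕ → ℂ) (n : ℕ) : ℂ :=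
  a0 * x n * x (n + 2) ^ 3 + b0 * x (n + 1) ^ 2 * x (n + 2) ^ 2
    - x n ^ 2 * x (n + 3) ^ 2

def D (a1 b1 : ℂ) (x : ℕ → ℂ) (n : ℕ) : ℂ :=
  a1 * x n * x (n + 2) ^ 3 + a1 * x (n + 1) ^ 3 * x (n + 3)
    + b1 * x (n + 1) ^ 2 * x (n + 2) ^ 2

/-- The third-order linear difference operator `L_n`, applied to the sequence `y`. -/
def L (a0 b0 : ℂ) (x y : ℕ → ℂ) (n : ℕ) : ℂ :=
  C3 a0 b0 x n * (x (n + 3))⁻¹ * y (n + 3) + C2 a0 b0 x n * (x (n + 2))⁻¹ * y (n + 2)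
    + C1 a0 b0 x n * (x (n + 1))⁻¹ * y (n + 1) + C0 a0 b0 x n * (x n)⁻¹ * y n

/-- The source term `F_n`; `J1` is the value of the second first integral. -/
def F (a1 b1 J1 : ℂ) (x : ℕ → ℂ) (n : ℕ) : ℂ :=
  D a1 b1 x n - J1 * (x n * x (n + 1) * x (n + 2) * x (n + 3))

/-- `Y 0, Y 1, Y 2` are three linearly independent solutions of the homogeneous equation
`L_n (y_n) = 0`. -/
def IsHomogeneousTriple (a0 b0 : ℂ) (x : ℕ → ℂ) (Y : Fin 3 → ℕ → ℂ) : Prop :=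
  (∀ j n, L a0 b0 x (Y j) n = 0) ∧ LinearIndependent ℂ Y

/-- The ratio `d_{n+1} = x_{n+2} x_n / x_{n+1}^2` (so that only nonnegative indices occur). -/
def dNext (x : ℕ → ℂ) (n : ℕ) : ℂ := x (n + 2) * x n / x (n + 1) ^ 2

/-- `v` together with the ratios `d_1, d_2, …` of `x` is an orbit of the map
`v_m = - v_{m-1} + u / d_m`, `d_{m+1} = - d_m - v_m ^ 2 - f`, for all `m = n + 1 ≥ 1`. -/
def IsAssociatedOrbit (u f : ℂ) (x v : ℕ → ℂ) : Prop :=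
  ∀ n, v (n + 1) = - v n + u / dNext x n ∧
    dNext x (n + 1) = - dNext x n - v (n + 1) ^ 2 - f

/-- The three shadow sequences `x_n`, `n x_n` and `- x_n ∑_{j<n} v_j`. -/
def shadowTriple (x v : ℕ → ℂ) : Fin 3 → ℕ → ℂ :=
  ![fun n => x n, fun n => (n : ℂ) * x n, fun n => - x n * ∑ j ∈ Finset.range n, v j]

/-- The determinant with rows `n + 1`, `n + 2`, `n + 3` of the three sequences. -/
def casoratian (Y : Fin 3 → ℕ → ℂ) (n : ℕ) : ℂ :=
  Matrix.det !![Y 0 (n + 1), Y 1 (n + 1), Y 2 (n + 1);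
                Y 0 (n + 2), Y 1 (n + 2), Y 2 (n + 2);
                Y 0 (n + 3), Y 1 (n + 3), Y 2 (n + 3)]

/-- The increments: component `j` of the vector given by Cramer's rule. -/
def increment (a0 b0 a1 b1 J1 : ℂ) (x : ℕ → ℂ) (Y : Fin 3 → ℕ → ℂ) (n : ℕ) : Fin 3 → ℂ :=
  (x (n + 3) * F a1 b1 J1 x n / C3 a0 b0 x n * (casoratian Y n)⁻¹) •
    ![Y 1 (n + 1) * Y 2 (n + 2) - Y 2 (n + 1) * Y 1 (n + 2),
      Y 2 (n + 1) * Y 0 (n + 2) - Y 0 (n + 1) * Y 2 (n + 2),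
      Y 0 (n + 1) * Y 1 (n + 2) - Y 1 (n + 1) * Y 0 (n + 2)]

/-- The coefficient `f_n^{(j)}` with initial value `c j`. -/
def coeff (a0 b0 a1 b1 J1 : ℂ) (x : ℕ → ℂ) (Y : Fin 3 → ℕ → ℂ) (c : Fin 3 → ℂ)
    (j : Fin 3) (n : ℕ) : ℂ :=
  c j + ∑ k ∈ Finset.range n, increment a0 b0 a1 b1 J1 x Y k j

/-- The sequence `y_n = ∑_j f_n^{(j)} y_n^{(j)}`. -/
def variationSolution (a0 b0 a1 b1 J1 : ℂ) (x : ℕ → ℂ) (Y : Fin 3 → ℕ → ℂ) (c : Fin 3 → ℂ) :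
    ℕ → ℂ :=
  fun n => ∑ j, coeff a0 b0 a1 b1 J1 x Y c j n * Y j n

end ShadowSomos

end

namespace ShadowSomos

variable {a0 b0 a1 b1 : ℂ} {x : ℕ → ℂ}

/-! Write E_n = x_n x_{n+3}² - x_{n+1}² x_{n+4}. The Somos relation gives `C3` (n+1) = x_{n+4} E_n
and `C0` n = -x_n E_n, so nonvanishing of `C3` lets L_n(y_n) = 0 be solved backwards as well as
forwards: three consecutive values determine a solution, and the determinant of independent
solutions never vanishes. Variation of parameters then gives the inhomogeneous equation.

The odd equation enters through `odd_identity`: (D_n - L_n(y_n)) / (x_n x_{n+1} x_{n+2} x_{n+3})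
changes from n to n+1 by a multiple of the residual of (O), with a factor proportional to E_n. So it
is a first integral of (O), its value is J1, and since E_n ≠ 0 its constancy implies (O) in turn.

For the shadow sequences, put y = x s. The coefficients on s sum to zero, also when weighted by i,
which gives s = 1 and s = n; for the third, the equation for the differences of s reduces to the
invariant relation `IsAssociatedOrbit.two_mul_eq`. -/

theorem dNext_ne_zero (hx0 : ∀ n, x n ≠ 0) (n : ℕ) : dNext x n ≠ 0 :=
  div_ne_zero (mul_ne_zero (hx0 _) (hx0 _)) (pow_ne_zero _ (hx0 _))

theorem dNext_somos (hx : IsSomosFour a0 b0 x) (hx0 : ∀ n, x n ≠ 0) (n : ℕ) :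
    dNext x (n + 2) * dNext x (n + 1) ^ 2 * dNext x n = a0 * dNext x (n + 1) + b0 := by
  have h := hx n
  have h1 := hx0 (n + 1)
  have h2 := hx0 (n + 2)
  have h3 := hx0 (n + 3)
  simp only [dNext, add_assoc, Nat.reduceAdd]
  field_simp
  linear_combination h

/-! ### Leading and trailing coefficients of `L` -/

theorem C0_eq_dNext (hx0 : ∀ n, x n ≠ 0) (n : ℕ) :
    C0 a0 b0 x n = x (n + 1) ^ 2 * x (n + 2) ^ 2 *
      (a0 * dNext x (n + 1) + b0 - dNext x n ^ 2 * dNext x (n + 1) ^ 2) := by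
  have h1 := hx0 (n + 1)
  have h2 := hx0 (n + 2)
  simp only [C0, dNext, add_assoc, Nat.reduceAdd]
  field_simp

theorem C3_eq_dNext (hx0 : ∀ n, x n ≠ 0) (n : ℕ) :
    C3 a0 b0 x n = x (n + 1) ^ 2 * x (n + 2) ^ 2 *
      (a0 * dNext x n + b0 - dNext x n ^ 2 * dNext x (n + 1) ^ 2) := by
  have h1 := hx0 (n + 1)
  have h2 := hx0 (n + 2)
  simp only [C3, dNext, add_assoc, Nat.reduceAdd]
  field_simp

theorem C3_succ_eq (hx : IsSomosFour a0 b0 x) (n : ℕ) :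
    C3 a0 b0 x (n + 1) = x (n + 4) * (x (n + 3) ^ 2 * x n - x (n + 1) ^ 2 * x (n + 4)) := by
  have h := hx n
  simp only [C3, add_assoc, Nat.reduceAdd]
  linear_combination (-x (n + 3) ^ 2) * h

theorem C0_eq (hx : IsSomosFour a0 b0 x) (n : ℕ) :
    C0 a0 b0 x n = -x n * (x (n + 3) ^ 2 * x n - x (n + 1) ^ 2 * x (n + 4)) := by
  have h := hx n
  simp only [C0]
  linear_combination (-x (n + 1) ^ 2) * h

theorem C0_ne_zero (hx : IsSomosFour a0 b0 x) (hx0 : ∀ n, x n ≠ 0)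
    (hC : ∀ n, C3 a0 b0 x n ≠ 0) (n : ℕ) : C0 a0 b0 x n ≠ 0 := by
  rw [C0_eq hx]
  have h := hC (n + 1)
  rw [C3_succ_eq hx] at h
  exact mul_ne_zero (neg_ne_zero.2 (hx0 n)) (right_ne_zero_of_mul h)

/-! ### The shadow sequences -/

/-- The value of `v_{n+1}` forced by the constancy of `d_{m+1} + d_m + v_m ^ 2`. -/
noncomputable def orbitValue (u : ℂ) (x : ℕ → ℂ) (n : ℕ) : ℂ :=
  ((dNext x (n + 2) - dNext x n) * dNext x (n + 1) / u + u / dNext x (n + 1)) / 2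

/-- Cleared of denominators, this is the difference of two consecutive Somos relations for the
ratios; `b0` cancels. -/
theorem orbitValue_succ (hx : IsSomosFour a0 b0 x) (hx0 : ∀ n, x n ≠ 0) {u : ℂ} (hu : u ≠ 0)
    (hua : u ^ 2 = a0) (n : ℕ) :
    orbitValue u x (n + 1) = -orbitValue u x n + u / dNext x (n + 1) := by
  have hs := dNext_somos hx hx0 n
  have hs' := dNext_somos hx hx0 (n + 1)
  simp only [orbitValue, add_assoc, Nat.reduceAdd] at *
  have h1 := dNext_ne_zero hx0 (n + 1)
  have h2 := dNext_ne_zero hx0 (n + 2)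
  subst hua
  field_simp
  linear_combination hs' - hs

theorem dNext_sub_eq (hx0 : ∀ n, x n ≠ 0) {u : ℂ} (hu : u ≠ 0) (n : ℕ) :
    dNext x (n + 2) - dNext x n =
      (2 * orbitValue u x n - u / dNext x (n + 1)) * (u / dNext x (n + 1)) := by
  have h1 := dNext_ne_zero hx0 (n + 1)
  simp only [orbitValue]
  field_simp
  ring

theorem exists_isAssociatedOrbit (hx : IsSomosFour a0 b0 x) (hx0 : ∀ n, x n ≠ 0) {u : ℂ}
    (hu : u ≠ 0) (hua : u ^ 2 = a0) : ∃ f v, IsAssociatedOrbit u f x v := by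
  -- `f` is read off from the first instance of the second relation; `v 0` occurs only in the first
  -- relation at n = 0, which defines it.
  refine ⟨-(dNext x 1 + dNext x 0 + orbitValue u x 0 ^ 2),
    fun n => Nat.casesOn n (u / dNext x 0 - orbitValue u x 0) (orbitValue u x), fun n => ⟨?_, ?_⟩⟩
  · cases n with
    | zero => simp
    | succ n => exact orbitValue_succ hx hx0 hu hua n
  · show dNext x (n + 1) = -dNext x n - orbitValue u x n ^ 2 - _
    induction n with
    | zero => ring
    | succ n ih =>
      rw [orbitValue_succ hx hx0 hu hua n]
      linear_combination ih + dNext_sub_eq hx0 hu n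

/-- Subtracting consecutive `d`-relations eliminates f and expresses d_{m+2} through d_m, d_{m+1}
and v_m; inserting this in the Somos relation for the ratios leaves the identity. -/
theorem IsAssociatedOrbit.two_mul_eq (hx : IsSomosFour a0 b0 x) (hx0 : ∀ n, x n ≠ 0) {u f : ℂ}
    (hua : u ^ 2 = a0) {v : ℕ → ℂ} (hv : IsAssociatedOrbit u f x v) (n : ℕ) :
    2 * u * v (n + 1) * dNext x n * dNext x (n + 1) =
      a0 * (dNext x n + dNext x (n + 1)) + b0 - dNext x n ^ 2 * dNext x (n + 1) ^ 2 := by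
  have hs := dNext_somos hx hx0 n
  have hd := (hv n).2
  obtain ⟨hv1, hd1⟩ := hv (n + 1)
  have h1 := dNext_ne_zero hx0 (n + 1)
  simp only [add_assoc, Nat.reduceAdd] at hv1 hd1
  have hw : u / dNext x (n + 1) * dNext x (n + 1) = u := div_mul_cancel₀ _ h1
  rw [hv1] at hd1
  generalize u / dNext x (n + 1) = w at *
  generalize dNext x (n + 2) = e at *
  generalize dNext x (n + 1) = d at *
  generalize dNext x n = c at *
  have he : e = c + (2 * v (n + 1) - w) * w := by linear_combination hd1 - hd
  subst he hua
  linear_combination hs - (2 * c * d * v (n + 1) - c * w * d - c * u) * hw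

theorem L_shadow_const (hx0 : ∀ n, x n ≠ 0) (n : ℕ) : L a0 b0 x x n = 0 := by
  simp only [L, mul_assoc, inv_mul_cancel₀ (hx0 _), C0, C1, C2, C3]
  ring

theorem L_shadow_linear (hx0 : ∀ n, x n ≠ 0) (n : ℕ) :
    L a0 b0 x (fun n => (n : ℂ) * x n) n = 0 := by
  simp only [L, mul_assoc, mul_left_comm _ (Nat.cast _ : ℂ), inv_mul_cancel₀ (hx0 _), C0, C1, C2,
    C3]
  push_cast
  ring

theorem L_mul_left (hx0 : ∀ n, x n ≠ 0) (s : ℕ → ℂ) (n : ℕ) :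
    L a0 b0 x (fun n => x n * s n) n = C3 a0 b0 x n * s (n + 3) + C2 a0 b0 x n * s (n + 2)
      + C1 a0 b0 x n * s (n + 1) + C0 a0 b0 x n * s n := by
  simp only [L, mul_assoc, inv_mul_cancel_left₀ (hx0 _)]

theorem L_shadow_orbit (hx : IsSomosFour a0 b0 x) (hx0 : ∀ n, x n ≠ 0) {u f : ℂ}
    (hua : u ^ 2 = a0) {v : ℕ → ℂ} (hv : IsAssociatedOrbit u f x v) (n : ℕ) :
    L a0 b0 x (fun n => -x n * ∑ j ∈ Finset.range n, v j) n = 0 := by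
  simp only [neg_mul_comm]
  have hv0 := (hv n).1
  have hv1 := (hv (n + 1)).1
  have hw := hv.two_mul_eq hx hx0 hua n
  have h0 := dNext_ne_zero hx0 n
  have h1 := dNext_ne_zero hx0 (n + 1)
  rw [L_mul_left hx0 (fun n => -∑ j ∈ Finset.range n, v j)]
  simp only [Finset.sum_range_succ]
  have e1 : C0 a0 b0 x n + C1 a0 b0 x n + C2 a0 b0 x n + C3 a0 b0 x n = 0 := by
    simp only [C0, C1, C2, C3]; ring
  have e2 : C2 a0 b0 x n + C3 a0 b0 x n =
      x (n + 1) ^ 2 * x (n + 2) ^ 2 * (a0 * (dNext x (n + 1) - dNext x n)) := by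
    have h1 := hx0 (n + 1)
    have h2 := hx0 (n + 2)
    simp only [C2, C3, dNext, add_assoc, Nat.reduceAdd]
    field_simp
    ring
  have e0 := C0_eq_dNext (a0 := a0) (b0 := b0) hx0 n
  have e3 := C3_eq_dNext (a0 := a0) (b0 := b0) hx0 n
  -- Summation by parts: the second-order equation for the differences of s. Writing v_n and v_{n+2}
  -- in terms of v_{n+1} turns it into (c - d) times the invariant relation.
  have key : C0 a0 b0 x n * v n - (C2 a0 b0 x n + C3 a0 b0 x n) * v (n + 1)
      - C3 a0 b0 x n * v (n + 2) = 0 := by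
    have hvn : v n = u / dNext x n - v (n + 1) := by linear_combination hv0
    rw [hvn, show v (n + 2) = _ from hv1, e0, e2, e3]
    generalize dNext x (n + 1) = d at *
    generalize dNext x n = c at *
    generalize v (n + 1) = w at *
    subst hua
    field_simp
    linear_combination x (n + 1) ^ 2 * x (n + 2) ^ 2 * u * (c - d) * hw
  linear_combination (-∑ j ∈ Finset.range n, v j - v n) * e1 + key

theorem linearIndependent_shadowTriple (hx : IsSomosFour a0 b0 x) (hx0 : ∀ n, x n ≠ 0)
    (hC : ∀ n, C3 a0 b0 x n ≠ 0) {u f : ℂ} {v : ℕ → ℂ} (hv : IsAssociatedOrbit u f x v) :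
    LinearIndependent ℂ (shadowTriple x v) := by
  rw [Fintype.linearIndependent_iff]
  intro g hg
  have h (n : ℕ) : g 0 + g 1 * n - g 2 * ∑ j ∈ Finset.range n, v j = 0 := by
    have := congrFun hg n
    simp only [Fin.sum_univ_three, shadowTriple, Pi.add_apply, Pi.smul_apply, smul_eq_mul,
      Pi.zero_apply, Matrix.cons_val] at this
    exact (mul_eq_zero.1 (by linear_combination this : x n * _ = 0)).resolve_left (hx0 n)
  have hg0 : g 0 = 0 := by simpa using h 0
  have hstep (n : ℕ) : g 1 = g 2 * v n := by
    have h1 := h (n + 1)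
    rw [Finset.sum_range_succ] at h1
    push_cast at h1
    linear_combination h1 - h n
  -- Otherwise v is constant, so d_3 = d_1, and the Somos relation for the ratios forces `C3` to
  -- vanish at 1.
  have hg2 : g 2 = 0 := by
    by_contra hne
    have hc (m n : ℕ) : v m = v n := mul_left_cancel₀ hne ((hstep m).symm.trans (hstep n))
    have hd : dNext x 2 = dNext x 0 := by
      have h1 := (hv 0).2
      have h2 := (hv 1).2
      simp only [zero_add, Nat.reduceAdd] at h1 h2
      rw [hc 2 1] at h2
      linear_combination h2 - h1
    refine hC 1 ?_
    have hs := dNext_somos hx hx0 0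
    simp only [zero_add] at hs
    rw [C3_eq_dNext hx0, ← hs, hd]
    simp only [Nat.reduceAdd]
    ring
  have hg1 : g 1 = 0 := by simpa [hg2] using hstep 0
  intro i
  fin_cases i
  exacts [hg0, hg1, hg2]

theorem isHomogeneousTriple_shadowTriple (hx : IsSomosFour a0 b0 x) (hx0 : ∀ n, x n ≠ 0)
    (hC : ∀ n, C3 a0 b0 x n ≠ 0) {u f : ℂ} (hua : u ^ 2 = a0) {v : ℕ → ℂ}
    (hv : IsAssociatedOrbit u f x v) : IsHomogeneousTriple a0 b0 x (shadowTriple x v) := by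
  refine ⟨fun j n => ?_, linearIndependent_shadowTriple hx hx0 hC hv⟩
  fin_cases j
  exacts [L_shadow_const hx0 n, L_shadow_linear hx0 n, L_shadow_orbit hx hx0 hua hv n]

/-! ### The homogeneous equation -/

theorem L_sub (y z : ℕ → ℂ) (n : ℕ) :
    L a0 b0 x (y - z) n = L a0 b0 x y n - L a0 b0 x z n := by
  simp only [L, Pi.sub_apply]
  ring

theorem L_sum (c : Fin 3 → ℂ) (Y : Fin 3 → ℕ → ℂ) (n : ℕ) :
    L a0 b0 x (∑ j, c j • Y j) n = ∑ j, c j * L a0 b0 x (Y j) n := by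
  simp only [L, Fin.sum_univ_three, Pi.add_apply, Pi.smul_apply, smul_eq_mul]
  ring

theorem eq_zero_of_initial (hx0 : ∀ n, x n ≠ 0) (hC : ∀ n, C3 a0 b0 x n ≠ 0) {y : ℕ → ℂ}
    (hy : ∀ n, L a0 b0 x y n = 0) (h0 : y 0 = 0) (h1 : y 1 = 0) (h2 : y 2 = 0) : y = 0 := by
  have key (n : ℕ) : y n = 0 ∧ y (n + 1) = 0 ∧ y (n + 2) = 0 := by
    induction n with
    | zero => exact ⟨h0, h1, h2⟩
    | succ n ih =>
      obtain ⟨h0, h1, h2⟩ := ih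
      have := hy n
      simp only [L, h0, h1, h2, mul_zero, add_zero] at this
      exact ⟨h1, h2, (mul_eq_zero.1 this).resolve_left
        (mul_ne_zero (hC n) (inv_ne_zero (hx0 _)))⟩
  exact funext fun n => (key n).1

/-- Since `C0` does not vanish, the zeros propagate back to the initial values. -/
theorem eq_zero_of_consecutive (hx : IsSomosFour a0 b0 x) (hx0 : ∀ n, x n ≠ 0)
    (hC : ∀ n, C3 a0 b0 x n ≠ 0) {y : ℕ → ℂ} (hy : ∀ n, L a0 b0 x y n = 0) (k : ℕ)
    (h0 : y k = 0) (h1 : y (k + 1) = 0) (h2 : y (k + 2) = 0) : y = 0 := by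
  induction k with
  | zero => exact eq_zero_of_initial hx0 hC hy h0 h1 h2
  | succ k ih =>
    refine ih ?_ h0 h1
    have := hy k
    simp only [L, show y (k + 1) = 0 from h0, show y (k + 2) = 0 from h1,
      show y (k + 3) = 0 from h2, mul_zero, zero_add] at this
    exact (mul_eq_zero.1 this).resolve_left
      (mul_ne_zero (C0_ne_zero hx hx0 hC k) (inv_ne_zero (hx0 _)))

/-- The matrix whose rows are the values of the three sequences at `k`, `k + 1`, `k + 2`. -/
def window (Y : Fin 3 → ℕ → ℂ) (k : ℕ) : Matrix (Fin 3) (Fin 3) ℂ :=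
  Matrix.of fun i j => Y j (k + i)

theorem det_window_ne_zero (hx : IsSomosFour a0 b0 x) (hx0 : ∀ n, x n ≠ 0)
    (hC : ∀ n, C3 a0 b0 x n ≠ 0) {Y : Fin 3 → ℕ → ℂ} (hY : IsHomogeneousTriple a0 b0 x Y)
    (k : ℕ) : (window Y k).det ≠ 0 := by
  intro hdet
  obtain ⟨c, hc, hM⟩ := Matrix.exists_mulVec_eq_zero_iff.2 hdet
  have hz (i : Fin 3) : (∑ j, c j • Y j) (k + i) = 0 := by
    have := congrFun hM i
    simp only [Matrix.mulVec, dotProduct, window, Matrix.of_apply, Pi.zero_apply] at this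
    rw [← this]
    simp only [Finset.sum_apply, Pi.smul_apply, smul_eq_mul, mul_comm]
  refine hc (funext (Fintype.linearIndependent_iff.1 hY.2 c ?_))
  refine eq_zero_of_consecutive hx hx0 hC (fun n => ?_) k (hz 0) (hz 1) (hz 2)
  simp [L_sum, hY.1]

theorem casoratian_eq_det_window (Y : Fin 3 → ℕ → ℂ) (n : ℕ) :
    casoratian Y n = (window Y (n + 1)).det := by
  simp [casoratian, window, Matrix.det_fin_three, add_assoc]

theorem casoratian_ne_zero (hx : IsSomosFour a0 b0 x) (hx0 : ∀ n, x n ≠ 0)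
    (hC : ∀ n, C3 a0 b0 x n ≠ 0) {Y : Fin 3 → ℕ → ℂ} (hY : IsHomogeneousTriple a0 b0 x Y)
    (n : ℕ) : casoratian Y n ≠ 0 := by
  rw [casoratian_eq_det_window]
  exact det_window_ne_zero hx hx0 hC hY _

/-! ### Variation of parameters -/

theorem sum_increment_one (J1 : ℂ) (Y : Fin 3 → ℕ → ℂ) (n : ℕ) :
    ∑ j, increment a0 b0 a1 b1 J1 x Y n j * Y j (n + 1) = 0 := by
  simp only [increment, Fin.sum_univ_three, Pi.smul_apply, smul_eq_mul, Matrix.cons_val]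
  ring

theorem sum_increment_two (J1 : ℂ) (Y : Fin 3 → ℕ → ℂ) (n : ℕ) :
    ∑ j, increment a0 b0 a1 b1 J1 x Y n j * Y j (n + 2) = 0 := by
  simp only [increment, Fin.sum_univ_three, Pi.smul_apply, smul_eq_mul, Matrix.cons_val]
  ring

/-- Expansion of the determinant along its last row. -/
theorem sum_increment_three (J1 : ℂ) {Y : Fin 3 → ℕ → ℂ} {n : ℕ} (hW : casoratian Y n ≠ 0) :
    ∑ j, increment a0 b0 a1 b1 J1 x Y n j * Y j (n + 3) =
      x (n + 3) * F a1 b1 J1 x n / C3 a0 b0 x n := by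
  have hinv : (casoratian Y n)⁻¹ * casoratian Y n = 1 := inv_mul_cancel₀ hW
  have hdet : casoratian Y n = _ := Matrix.det_fin_three _
  simp only [Matrix.of_apply, Matrix.cons_val] at hdet
  simp only [increment, Fin.sum_univ_three, Pi.smul_apply, smul_eq_mul, Matrix.cons_val]
  linear_combination (x (n + 3) * F a1 b1 J1 x n / C3 a0 b0 x n) * hinv
    - (x (n + 3) * F a1 b1 J1 x n / C3 a0 b0 x n * (casoratian Y n)⁻¹) * hdet

theorem sum_coeff_succ (J1 : ℂ) (Y : Fin 3 → ℕ → ℂ) (c : Fin 3 → ℂ) (n m : ℕ) :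
    ∑ j, coeff a0 b0 a1 b1 J1 x Y c j (n + 1) * Y j m =
      ∑ j, coeff a0 b0 a1 b1 J1 x Y c j n * Y j m
        + ∑ j, increment a0 b0 a1 b1 J1 x Y n j * Y j m := by
  simp only [coeff, Finset.sum_range_succ, ← Finset.sum_add_distrib]
  exact Finset.sum_congr rfl fun j _ => by ring

theorem variationSolution_one (J1 : ℂ) (Y : Fin 3 → ℕ → ℂ) (c : Fin 3 → ℂ) (n : ℕ) :
    variationSolution a0 b0 a1 b1 J1 x Y c (n + 1) =
      ∑ j, coeff a0 b0 a1 b1 J1 x Y c j n * Y j (n + 1) := by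
  rw [variationSolution, sum_coeff_succ, sum_increment_one, add_zero]

/-- The two constraints allow the coefficients to be frozen at index n over the window; only the
value at n + 3 acquires an extra term, which produces the source. -/
theorem variationSolution_two (J1 : ℂ) (Y : Fin 3 → ℕ → ℂ) (c : Fin 3 → ℂ) (n : ℕ) :
    variationSolution a0 b0 a1 b1 J1 x Y c (n + 2) =
      ∑ j, coeff a0 b0 a1 b1 J1 x Y c j n * Y j (n + 2) := by
  rw [variationSolution_one J1 Y c (n + 1), sum_coeff_succ, sum_increment_two, add_zero]

theorem variationSolution_three (J1 : ℂ) {Y : Fin 3 → ℕ → ℂ} (c : Fin 3 → ℂ) {n : ℕ}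
    (hW : casoratian Y n ≠ 0) :
    variationSolution a0 b0 a1 b1 J1 x Y c (n + 3) =
      ∑ j, coeff a0 b0 a1 b1 J1 x Y c j n * Y j (n + 3)
        + x (n + 3) * F a1 b1 J1 x n / C3 a0 b0 x n := by
  rw [variationSolution_two J1 Y c (n + 1), sum_coeff_succ, sum_increment_three J1 hW]

theorem L_variationSolution (hx : IsSomosFour a0 b0 x) (hx0 : ∀ n, x n ≠ 0)
    (hC : ∀ n, C3 a0 b0 x n ≠ 0) {Y : Fin 3 → ℕ → ℂ} (hY : IsHomogeneousTriple a0 b0 x Y)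
    (J1 : ℂ) (c : Fin 3 → ℂ) (n : ℕ) :
    L a0 b0 x (variationSolution a0 b0 a1 b1 J1 x Y c) n = F a1 b1 J1 x n := by
  have h := L_sum (a0 := a0) (b0 := b0) (x := x)
    (fun j => coeff a0 b0 a1 b1 J1 x Y c j n) Y n
  simp only [hY.1, mul_zero, Finset.sum_const_zero] at h
  have hF : C3 a0 b0 x n * (x (n + 3))⁻¹ * (x (n + 3) * F a1 b1 J1 x n / C3 a0 b0 x n) =
      F a1 b1 J1 x n := by
    have h1 := hx0 (n + 3)
    have h2 := hC n
    field_simp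
  rw [L] at h ⊢
  rw [variationSolution_three J1 c (casoratian_ne_zero hx hx0 hC hY n), variationSolution_two,
    variationSolution_one]
  simp only [variationSolution]
  simp only [Finset.sum_apply, Pi.smul_apply, smul_eq_mul] at h
  linear_combination h + hF

theorem existsUnique_variationSolution (hx : IsSomosFour a0 b0 x) (hx0 : ∀ n, x n ≠ 0)
    (hC : ∀ n, C3 a0 b0 x n ≠ 0) {Y : Fin 3 → ℕ → ℂ} (hY : IsHomogeneousTriple a0 b0 x Y)
    (J1 : ℂ) {y : ℕ → ℂ} (hy : ∀ n, L a0 b0 x y n = F a1 b1 J1 x n) :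
    ∃! c : Fin 3 → ℂ, y = variationSolution a0 b0 a1 b1 J1 x Y c := by
  have hdet := det_window_ne_zero hx hx0 hC hY 0
  have hunit : IsUnit (window Y 0) :=
    (Matrix.isUnit_iff_isUnit_det _).2 (isUnit_iff_ne_zero.2 hdet)
  -- Freezing at n = 0 makes the first three values linear in c, independently of J1.
  have hval (c : Fin 3 → ℂ) (i : Fin 3) :
      variationSolution a0 b0 a1 b1 J1 x Y c i = (window Y 0).mulVec c i := by
    have hw : (window Y 0).mulVec c i = ∑ j, coeff a0 b0 a1 b1 J1 x Y c j 0 * Y j i := by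
      simp [Matrix.mulVec, dotProduct, window, coeff, mul_comm]
    rw [hw]
    fin_cases i
    exacts [rfl, variationSolution_one J1 Y c 0, variationSolution_two J1 Y c 0]
  obtain ⟨c, hc⟩ := Matrix.mulVec_surjective_iff_isUnit.2 hunit fun i => y i
  refine ⟨c, ?_, fun c' hc' => Matrix.mulVec_injective_iff_isUnit.2 hunit ?_⟩
  · have hi (i : Fin 3) : (y - variationSolution a0 b0 a1 b1 J1 x Y c) i = 0 := by
      rw [Pi.sub_apply, hval, hc, sub_self]
    refine sub_eq_zero.1 (eq_zero_of_initial hx0 hC (fun n => ?_) (hi 0) (hi 1) (hi 2))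
    rw [L_sub, hy, L_variationSolution hx hx0 hC hY, sub_self]
  · rw [hc]
    funext i
    rw [← hval, ← hc']

/-! ### The odd equation -/

theorem odd_identity (hx : IsSomosFour a0 b0 x) (hx0 : ∀ n, x n ≠ 0) (y : ℕ → ℂ) (n : ℕ) :
    x n * (D a1 b1 x (n + 1) - L a0 b0 x y (n + 1)) - x (n + 4) * (D a1 b1 x n - L a0 b0 x y n) =
      (x (n + 1) ^ 2 * x (n + 4) - x (n + 3) ^ 2 * x n) *
        (x n * y (n + 4) - a0 * x (n + 1) * y (n + 3) - 2 * b0 * x (n + 2) * y (n + 2)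
          - a0 * x (n + 3) * y (n + 1) + x (n + 4) * y n
          - (a1 * x (n + 1) * x (n + 3) + b1 * x (n + 2) ^ 2)) := by
  have h := hx n
  have h0 := hx0 n
  have h1 := hx0 (n + 1)
  have h2 := hx0 (n + 2)
  have h3 := hx0 (n + 3)
  have h4 := hx0 (n + 4)
  -- Eliminating `b0` leaves a rational identity in free values of x and y.
  have hb : b0 = (x (n + 4) * x n - a0 * (x (n + 3) * x (n + 1))) / x (n + 2) ^ 2 := by
    field_simp
    linear_combination -h
  simp only [L, D, C0, C1, C2, C3, add_assoc, Nat.reduceAdd]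
  rw [hb]
  field_simp
  ring

theorem isOddSolution_of_L_eq (hx : IsSomosFour a0 b0 x) (hx0 : ∀ n, x n ≠ 0)
    (hC : ∀ n, C3 a0 b0 x n ≠ 0) {J1 : ℂ} {y : ℕ → ℂ}
    (hy : ∀ n, L a0 b0 x y n = F a1 b1 J1 x n) : IsOddSolution a0 b0 a1 b1 x y := by
  intro n
  have hne := hC (n + 1)
  rw [C3_succ_eq hx] at hne
  have h := odd_identity (a1 := a1) (b1 := b1) hx hx0 y n
  rw [hy, hy, F, F] at h
  simp only [add_assoc, Nat.reduceAdd] at h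
  refine sub_eq_zero.1 (mul_left_cancel₀ (right_ne_zero_of_mul hne) ?_)
  linear_combination h

theorem exists_L_eq_of_isOddSolution (hx : IsSomosFour a0 b0 x) (hx0 : ∀ n, x n ≠ 0)
    {y : ℕ → ℂ} (hy : IsOddSolution a0 b0 a1 b1 x y) :
    ∃ J1, ∀ n, L a0 b0 x y n = F a1 b1 J1 x n := by
  refine ⟨(D a1 b1 x 0 - L a0 b0 x y 0) / (x 0 * x 1 * x 2 * x 3), fun n => ?_⟩
  induction n with
  | zero =>
    have h0 := hx0 0
    have h1 := hx0 1
    have h2 := hx0 2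
    have h3 := hx0 3
    simp only [F, zero_add]
    field_simp
    ring
  | succ n ih =>
    have h := odd_identity (a1 := a1) (b1 := b1) hx hx0 y n
    rw [hy n, ih] at h
    refine mul_left_cancel₀ (hx0 n) ?_
    simp only [F, add_assoc, Nat.reduceAdd] at h ⊢
    linear_combination -h

theorem F_injective (hx0 : ∀ n, x n ≠ 0) {J J' : ℂ} {n : ℕ}
    (h : F a1 b1 J x n = F a1 b1 J' x n) : J = J' :=
  mul_right_cancel₀
    (mul_ne_zero (mul_ne_zero (mul_ne_zero (hx0 n) (hx0 (n + 1))) (hx0 (n + 2))) (hx0 (n + 3)))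
    (sub_right_injective h)

theorem existsUnique_variationSolution_of_isOddSolution (hx : IsSomosFour a0 b0 x)
    (hx0 : ∀ n, x n ≠ 0) (hC : ∀ n, C3 a0 b0 x n ≠ 0) {Y : Fin 3 → ℕ → ℂ}
    (hY : IsHomogeneousTriple a0 b0 x Y) {y : ℕ → ℂ} (hy : IsOddSolution a0 b0 a1 b1 x y) :
    ∃! p : ℂ × (Fin 3 → ℂ), y = variationSolution a0 b0 a1 b1 p.1 x Y p.2 := by
  obtain ⟨J, hJ⟩ := exists_L_eq_of_isOddSolution hx hx0 hy
  obtain ⟨c, hc, huniq⟩ := existsUnique_variationSolution hx hx0 hC hY J hJ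
  refine ⟨(J, c), hc, ?_⟩
  rintro ⟨J', c'⟩ h
  obtain rfl : J' = J := by
    refine F_injective (a1 := a1) (b1 := b1) (n := 0) hx0 ?_
    rw [← hJ 0, h, L_variationSolution hx hx0 hC hY]
  rw [huniq c' h]

end ShadowSomos

theorem mainTheorem1 (a0 b0 a1 b1 : ℂ) (x : ℕ → ℂ)
    (hx : ShadowSomos.IsSomosFour a0 b0 x) (hx0 : ∀ n, x n ≠ 0)
    (hC : ∀ n, ShadowSomos.C3 a0 b0 x n ≠ 0) :
    -- the explicit shadow sequences form a triple to which the formulae below apply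
    (∀ u : ℂ, u ≠ 0 → u ^ 2 = a0 →
      (∃ (f : ℂ) (v : ℕ → ℂ), ShadowSomos.IsAssociatedOrbit u f x v) ∧
      (∀ (f : ℂ) (v : ℕ → ℂ), ShadowSomos.IsAssociatedOrbit u f x v →
        ShadowSomos.IsHomogeneousTriple a0 b0 x (ShadowSomos.shadowTriple x v))) ∧
    (∀ Y : Fin 3 → ℕ → ℂ, ShadowSomos.IsHomogeneousTriple a0 b0 x Y →
      -- the determinant in the formula for the increments does not vanish
      (∀ n, ShadowSomos.casoratian Y n ≠ 0) ∧
      -- the constraints of variation of parameters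
      (∀ (J1 : ℂ) (n : ℕ),
        ∑ j, ShadowSomos.increment a0 b0 a1 b1 J1 x Y n j * Y j (n + 1) = 0 ∧
        ∑ j, ShadowSomos.increment a0 b0 a1 b1 J1 x Y n j * Y j (n + 2) = 0) ∧
      -- every sequence of this form solves the third-order equation
      (∀ (J1 : ℂ) (c : Fin 3 → ℂ) (n : ℕ),
        ShadowSomos.L a0 b0 x (ShadowSomos.variationSolution a0 b0 a1 b1 J1 x Y c) n
          = ShadowSomos.F a1 b1 J1 x n) ∧
      -- every solution of the third-order equation has this form, for unique parameters
      (∀ (J1 : ℂ) (y : ℕ → ℂ),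
        (∀ n, ShadowSomos.L a0 b0 x y n = ShadowSomos.F a1 b1 J1 x n) →
        ∃! c : Fin 3 → ℂ, y = ShadowSomos.variationSolution a0 b0 a1 b1 J1 x Y c) ∧
      -- every sequence of this form solves the odd equation
      (∀ (J1 : ℂ) (c : Fin 3 → ℂ), ShadowSomos.IsOddSolution a0 b0 a1 b1 x
        (ShadowSomos.variationSolution a0 b0 a1 b1 J1 x Y c)) ∧
      -- every solution of the odd equation has this form, for unique parameters
      (∀ y : ℕ → ℂ, ShadowSomos.IsOddSolution a0 b0 a1 b1 x y →
        ∃! p : ℂ × (Fin 3 → ℂ),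
          y = ShadowSomos.variationSolution a0 b0 a1 b1 p.1 x Y p.2)) := by
  refine ⟨fun u hu hua => ⟨ShadowSomos.exists_isAssociatedOrbit hx hx0 hu hua, fun f v hv =>
    ShadowSomos.isHomogeneousTriple_shadowTriple hx hx0 hC hua hv⟩, fun Y hY => ?_⟩
  have hL (J1 : ℂ) (c : Fin 3 → ℂ) (n : ℕ) :=
    ShadowSomos.L_variationSolution (a1 := a1) (b1 := b1) hx hx0 hC hY J1 c n
  exact ⟨ShadowSomos.casoratian_ne_zero hx hx0 hC hY,
    fun J1 n => ⟨ShadowSomos.sum_increment_one J1 Y n, ShadowSomos.sum_increment_two J1 Y n⟩,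
    hL,
    fun J1 y hy => ShadowSomos.existsUnique_variationSolution hx hx0 hC hY J1 hy,
    fun J1 c => ShadowSomos.isOddSolution_of_L_eq hx hx0 hC (hL J1 c),
    fun y hy => ShadowSomos.existsUnique_variationSolution_of_isOddSolution hx hx0 hC hY hy⟩
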